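/- Let $\lambda>0$ and let $W$ have the symmetric Skellam distribution $\mathrm{Skellam}(\lambda,\lambda)$ on $\mathbb Z$, i.e. $\mathbb P(W=k)=e^{-2\lambda}I_k(2\lambda)$ for $k\in\mathbb Z$, where $I_k$ denotes the modified Bessel function of the first kind of order $k$. For $x\in\mathbb R$ consider the Skellam Stein equation $$\lambda f(k+1)-k f(k)-\lambda f(k-1)=\mathbf 1\{k\le x\}-\mathbb P(W\le x),\qquad k\in\mathbb Z .$$ For every $x\in\mathbb R$ this equation has exactly one bounded solution $f=f_x:\mathbb Z\to\mathbb R$ with the initial value $$f_x(0)=\frac{e^{2\lambda}}{2\lambda}\,\frac{1}{I_0(2\lambda)+I_1(2\lambda)}\Big[\mathbb P(W\le \min\{0,x\})\,\mathbb P(W>\max\{0,x\})+\mathbb P(W\le \min\{-1,x\})\,\mathbb P(W>\max\{-1,x\})\Big],$$ and these solutions satisfy $$\|\Delta f\|:=\sup_{x\in\mathbb R}\,\sup_{j\in\mathbb Z}\,|f_x(j+1)-f_x(j)|\le\frac{156}{2\lambda}.$$ -/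

import Mathlib

open MeasureTheory

noncomputable section

/-- The modified Bessel function of the first kind `I_n(z)` of integer order `n`, for real `z`:
`I_n(z) = ∑_{k ≥ 0} (z / 2)^(2k + |n|) / (k! (k + |n|)!)`. -/
def besselI (n : ℤ) (z : ℝ) : ℝ :=
  ∑' k : ℕ, (z / 2) ^ (2 * k + n.natAbs) /
    ((Nat.factorial k : ℝ) * (Nat.factorial (k + n.natAbs) : ℝ))

/-- The probability `P(W = k)` for `W ∼ Skellam(l₁, l₂)`, where `l₁, l₂ > 0`. -/
def skellamProb (l₁ l₂ : ℝ) (k : ℤ) : ℝ :=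
  Real.exp (-(l₁ + l₂)) * Real.sqrt (l₁ / l₂) ^ k * besselI k (2 * Real.sqrt (l₁ * l₂))

/-- The Skellam distribution on `ℤ` with parameters `l₁, l₂ > 0`. -/
def skellamMeasure (l₁ l₂ : ℝ) : Measure ℤ :=
  Measure.sum fun k : ℤ => ENNReal.ofReal (skellamProb l₁ l₂ k) • Measure.dirac k

/-- `P(W ≤ t)` for `W ∼ Skellam(l₁, l₂)`. -/
def skellamCDF (l₁ l₂ t : ℝ) : ℝ :=
  (skellamMeasure l₁ l₂).real {k : ℤ | (k : ℝ) ≤ t}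

/-- `P(W > t)` for `W ∼ Skellam(l₁, l₂)`. -/
def skellamTail (l₁ l₂ t : ℝ) : ℝ :=
  (skellamMeasure l₁ l₂).real {k : ℤ | t < (k : ℝ)}

/-- The Skellam Stein operator `𝒜[f(k)] = l₁ f(k+1) - k f(k) - l₂ f(k-1)`. -/
def steinOp (l₁ l₂ : ℝ) (f : ℤ → ℝ) (k : ℤ) : ℝ :=
  l₁ * f (k + 1) - (k : ℝ) * f k - l₂ * f (k - 1)

/-- The test function `g_x(k) = 1{k ≤ x} - P(W ≤ x)`, where `W ∼ Skellam(l₁, l₂)`. -/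
def steinTest (l₁ l₂ x : ℝ) (k : ℤ) : ℝ :=
  (if (k : ℝ) ≤ x then 1 else 0) - skellamCDF l₁ l₂ x

/-- The initial value `f_x(0)` of the Stein solution in the symmetric case `l₁ = l₂ = l`:
with `W ∼ Skellam(l, l)` and `I_n = I_n(2l)` it is
`e^(2l) / (2l) * 1 / (I_0 + I_1) * [P(W ≤ min{0, x}) P(W > max{0, x})
  + P(W ≤ min{-1, x}) P(W > max{-1, x})]`. -/
def steinInit (l x : ℝ) : ℝ :=
  Real.exp (2 * l) / (2 * l) * (1 / (besselI 0 (2 * l) + besselI 1 (2 * l))) *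
    (skellamCDF l l (min 0 x) * skellamTail l l (max 0 x) +
      skellamCDF l l (min (-1) x) * skellamTail l l (max (-1) x))

/-- `f` is the Stein solution `f_x` in the symmetric case `l₁ = l₂ = l`: a bounded solution of
`𝒜[f(k)] = g_x(k)`, `k ∈ ℤ`, with the initial condition `f(0) = steinInit l x`. -/
structure IsSteinSolution (l x : ℝ) (f : ℤ → ℝ) : Prop where
  bounded : ∃ C : ℝ, ∀ k : ℤ, |f k| ≤ C
  equation : ∀ k : ℤ, steinOp l l f k = steinTest l l x k
  initial : f 0 = steinInit l x

/-- `‖Δf‖ = sup_{x ∈ ℝ} sup_{j ∈ ℤ} |f_x(j+1) - f_x(j)|`, as an element of `[0, ∞]`. -/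
def deltaNorm (f : ℝ → ℤ → ℝ) : ENNReal :=
  ⨆ x : ℝ, ⨆ j : ℤ, ENNReal.ofReal |f x (j + 1) - f x j|

end

/-! Multiplied by `p k`, the Stein equation telescopes (`steinOp_mul`). Every bounded solution with
the prescribed `f 0` comes from a first-order equation `l * (p k * f (k + 1) + p (k + 1) * f k) = F
k`, where `F` is `steinFlux`.

Put `s k = p k + p (k + 1)` and `e k = l * (f (k + 1) - f k) / s k`. Then `e k + e (k - 1) = ρ k`,
with `p k * ρ k` the increment of `F / s` (`scaled_diff_add`). If `0 ≤ e (k - 1) ≤ A (k - 1)` and `e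
k = A k - e (k - 1)` with `A` monotone, then `0 ≤ e k ≤ A k`, so alternation causes no growth. Up to
the jump `ρ` is monotone; beyond it `ρ` is a difference of two monotone sequences. The initial value
is exactly the one with `f 1 - f 0 = f 0 - f (-1)`, which gives `e 0 = ρ 0 / 2` and starts the
induction (`scaled_diff_bound`).

The tail bound `mul_tail_le` then gives `|f (k + 1) - f k| ≤ 4 / l` for `k ≥ 0`. Reflection covers
`k < 0`. -/

/-! ### Abstract weights, tail estimates and the flux. -/

/-- A positive even weight `p` on `ℤ` with the symmetric Skellam recurrence, and its tail `T`. -/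
structure IsSteinWeight (l : ℝ) (p T : ℤ → ℝ) : Prop where
  rate_pos : 0 < l
  pos : ∀ k, 0 < p k
  even : ∀ k, p (-k) = p k
  recurrence : ∀ k : ℤ, l * (p (k - 1) - p (k + 1)) = k * p k
  tail_sub : ∀ k, T (k - 1) - T k = p k
  tail_nonneg : ∀ k, 0 ≤ T k
  tail_reflect : ∀ k, T k + T (-k - 1) = 1
  tail_tendsto : Filter.Tendsto T Filter.atTop (nhds 0)

/-- The sum `∑_{j ≤ k} p_j g(j)` for `g(j) = 1{j ≤ m} - P(W ≤ m)`, in terms of the tail `T`. -/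
def steinFlux (T : ℤ → ℝ) (m k : ℤ) : ℝ := (1 - T (min k m)) * T (max k m)

namespace IsSteinWeight

variable {l : ℝ} {p T : ℤ → ℝ}

theorem tail_le_one (h : IsSteinWeight l p T) (k : ℤ) : T k ≤ 1 := by
  have := h.tail_reflect k
  have := h.tail_nonneg (-k - 1)
  linarith

theorem antitone_tail (h : IsSteinWeight l p T) : Antitone T := by
  refine antitone_int_of_succ_le fun k => ?_
  have h1 := h.tail_sub (k + 1)
  rw [add_sub_cancel_right] at h1
  have := h.pos (k + 1)
  linarith

theorem pair_pos (h : IsSteinWeight l p T) (k : ℤ) : 0 < p k + p (k + 1) :=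
  add_pos (h.pos _) (h.pos _)

theorem pair_sub (h : IsSteinWeight l p T) (k : ℤ) :
    (p (k - 1) + p k) - (p k + p (k + 1)) = k / l * p k := by
  have := h.recurrence k
  have hl := h.rate_pos
  field_simp
  linarith

theorem pair_le (h : IsSteinWeight l p T) {k : ℤ} (hk : 0 ≤ k) :
    p k + p (k + 1) ≤ p (k - 1) + p k := by
  have h1 := h.pair_sub k
  have h2 : 0 ≤ (k : ℝ) / l * p k :=
    mul_nonneg (div_nonneg (by exact_mod_cast hk) h.rate_pos.le) (h.pos k).le
  linarith

theorem tendsto_zero (h : IsSteinWeight l p T) : Filter.Tendsto p Filter.atTop (nhds 0) := by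
  have h1 : Filter.Tendsto (fun k : ℤ => T (k - 1) - T k) Filter.atTop (nhds (0 - 0)) :=
    (h.tail_tendsto.comp (Filter.tendsto_atTop_add_const_right _ (-1) Filter.tendsto_id)).sub
      h.tail_tendsto
  simpa [h.tail_sub] using h1

/-- Chernoff-type tail estimate `k P(W > k) ≤ l (p_k + p_{k+1})`. -/
theorem mul_tail_le (h : IsSteinWeight l p T) (k : ℤ) :
    k * T k ≤ l * (p k + p (k + 1)) := by
  -- By the recurrence `H (n + 1) - H n = -(n + 1) * p (k + n + 1) ≤ 0`, and `H` tends to `0`; hence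
  -- `H 0 ≥ 0`.
  let H : ℕ → ℝ := fun n => l * (p (k + n) + p (k + n + 1)) - k * T (k + n)
  have hH : Antitone H := by
    refine antitone_nat_of_succ_le fun n => ?_
    have h1 := h.recurrence (k + n + 1)
    have h2 := h.tail_sub (k + n + 1)
    have h3 := h.pos (k + n + 1)
    simp only [add_sub_cancel_right] at h1 h2
    have h4 : (0 : ℝ) ≤ n := Nat.cast_nonneg n
    simp only [H]
    push_cast at h1 ⊢
    simp only [← add_assoc]
    have h5 : T (k + n + 1) = T (k + n) - p (k + n + 1) := by linarith
    rw [h5]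
    nlinarith [mul_nonneg h4 h3.le]
  have hcast : Filter.Tendsto (fun n : ℕ => k + (n : ℤ)) Filter.atTop Filter.atTop :=
    Filter.tendsto_atTop_add_const_left _ k tendsto_natCast_atTop_atTop
  have hlim : Filter.Tendsto H Filter.atTop (nhds (l * (0 + 0) - k * 0)) := by
    refine ((((h.tendsto_zero.comp hcast).add (h.tendsto_zero.comp ?_)).const_mul l).sub
      ((h.tail_tendsto.comp hcast).const_mul _))
    exact Filter.tendsto_atTop_add_const_right _ 1 hcast
  have h0 := hH.le_of_tendsto hlim 0
  simp only [H] at h0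
  simp at h0
  linarith

theorem div_mul_tail_le (h : IsSteinWeight l p T) (k : ℤ) :
    k / l * T k ≤ p k + p (k + 1) := by
  have := h.mul_tail_le k
  have hl := h.rate_pos
  rw [div_mul_eq_mul_div, div_le_iff₀ hl]
  linarith

theorem div_nonneg_of_nonneg (h : IsSteinWeight l p T) {k : ℤ} (hk : 0 ≤ k) : 0 ≤ (k : ℝ) / l :=
  div_nonneg (by exact_mod_cast hk) h.rate_pos.le

theorem steinFlux_nonneg (h : IsSteinWeight l p T) (m k : ℤ) : 0 ≤ steinFlux T m k :=
  mul_nonneg (sub_nonneg.2 (h.tail_le_one _)) (h.tail_nonneg _)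

theorem steinFlux_le_tail (h : IsSteinWeight l p T) (m k : ℤ) : steinFlux T m k ≤ T k := by
  have h1 := h.tail_nonneg (min k m)
  have h2 := h.tail_nonneg (max k m)
  have h3 := h.antitone_tail (le_max_left k m)
  unfold steinFlux
  nlinarith

/-- The symmetry `W ↦ -W` exchanges the two factors of the flux. It reduces negative indices to
nonnegative ones. -/
theorem steinFlux_reflect (h : IsSteinWeight l p T) (m k : ℤ) :
    steinFlux T m (-k - 1) = steinFlux T (-m - 1) k := by
  have h1 : min (-k - 1) m = -(max k (-m - 1)) - 1 := by omega
  have h2 : min k (-m - 1) = -(max (-k - 1) m) - 1 := by omega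
  have h3 := h.tail_reflect (max k (-m - 1))
  have h4 := h.tail_reflect (max (-k - 1) m)
  unfold steinFlux
  rw [h1, h2, show T (-(max k (-m - 1)) - 1) = 1 - T (max k (-m - 1)) by linarith,
    show T (-(max (-k - 1) m) - 1) = 1 - T (max (-k - 1) m) by linarith]
  ring

theorem steinFlux_sub (h : IsSteinWeight l p T) (m k : ℤ) :
    steinFlux T m k - steinFlux T m (k - 1) = p k * ((if k ≤ m then 1 else 0) - (1 - T m)) := by
  have h1 := h.tail_sub k
  have h2 : T (k - 1) = T k + p k := by linarith
  unfold steinFlux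
  split_ifs with hk
  · rw [min_eq_left hk, max_eq_right hk, min_eq_left (by omega), max_eq_right (by omega), h2]
    ring
  · rw [min_eq_right (by omega), max_eq_left (by omega), min_eq_right (by omega),
      max_eq_left (by omega), h2]
    ring

end IsSteinWeight

/-! ### Monotone sequences governing the increments of flux over pair sum. -/

/-- The increment of `P(W ≤ k) / (p_k + p_{k+1})` divided by `p_k`. -/
noncomputable def lowerIncr (l : ℝ) (p T : ℤ → ℝ) (k : ℤ) : ℝ :=
  1 / (p k + p (k + 1)) + k / l * (1 - T (k - 1)) / ((p k + p (k + 1)) * (p (k - 1) + p k))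

/-- The positive part in a decomposition of the increments of `P(W > k) / (p_k + p_{k+1})`
into two monotone sequences. -/
noncomputable def upperIncrPos (p : ℤ → ℝ) (k : ℤ) : ℝ :=
  1 / (p (k - 1) + p k) + 1 / (p k + p (k + 1))

/-- The negative part in a decomposition of the increments of `P(W > k) / (p_k + p_{k+1})`
into two monotone sequences. -/
noncomputable def upperIncrNeg (l : ℝ) (p T : ℤ → ℝ) (k : ℤ) : ℝ :=
  1 / (p k + p (k + 1)) + k / l * T k / ((p k + p (k + 1)) * (p (k - 1) + p k))

namespace IsSteinWeight

variable {l : ℝ} {p T : ℤ → ℝ}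

theorem prev_pair_pos (h : IsSteinWeight l p T) (k : ℤ) : 0 < p (k - 1) + p k :=
  add_pos (h.pos _) (h.pos _)

theorem lowerIncr_nonneg (h : IsSteinWeight l p T) {k : ℤ} (hk : 0 ≤ k) :
    0 ≤ lowerIncr l p T k := by
  have h1 := h.pair_pos k
  have h2 := h.prev_pair_pos k
  have h3 := h.div_nonneg_of_nonneg hk
  have h4 := sub_nonneg.2 (h.tail_le_one (k - 1))
  unfold lowerIncr
  positivity

theorem upperIncrPos_nonneg (h : IsSteinWeight l p T) (k : ℤ) : 0 ≤ upperIncrPos p k := by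
  have h1 := h.pair_pos k
  have h2 := h.prev_pair_pos k
  unfold upperIncrPos
  positivity

theorem upperIncrNeg_nonneg (h : IsSteinWeight l p T) {k : ℤ} (hk : 0 ≤ k) :
    0 ≤ upperIncrNeg l p T k := by
  have h1 := h.pair_pos k
  have h2 := h.prev_pair_pos k
  have h3 := h.div_nonneg_of_nonneg hk
  have h4 := h.tail_nonneg k
  unfold upperIncrNeg
  positivity

theorem lowerIncr_le_succ (h : IsSteinWeight l p T) {k : ℤ} (hk : 0 ≤ k) :
    lowerIncr l p T k ≤ lowerIncr l p T (k + 1) := by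
  have h1 := h.pair_pos (k + 1)
  have h2 := h.pair_pos k
  have h3 := h.pair_le hk
  have h4 := h.pair_le (k := k + 1) (by omega)
  have h5 := h.div_nonneg_of_nonneg hk
  have h6 := sub_nonneg.2 (h.tail_le_one (k - 1))
  have h7 := h.antitone_tail (show k - 1 ≤ k by omega)
  have h8 : (k : ℝ) / l ≤ ((k + 1 : ℤ) : ℝ) / l := by
    have := h.rate_pos
    push_cast
    gcongr
    linarith
  have h9 := h5.trans h8
  have h10 := sub_nonneg.2 (h.tail_le_one k)
  have h11 := mul_nonneg h9 h10
  unfold lowerIncr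
  rw [add_sub_cancel_right] at *
  gcongr

theorem upperIncrPos_le_succ (h : IsSteinWeight l p T) {k : ℤ} (hk : 0 ≤ k) :
    upperIncrPos p k ≤ upperIncrPos p (k + 1) := by
  have h1 := h.pair_pos (k + 1)
  have h2 := h.pair_pos k
  have h3 := h.pair_le hk
  have h4 := h.pair_le (k := k + 1) (by omega)
  unfold upperIncrPos
  rw [add_sub_cancel_right] at *
  gcongr

theorem upperIncrNeg_le_succ (h : IsSteinWeight l p T) {k : ℤ} (hk : 0 ≤ k) :
    upperIncrNeg l p T k ≤ upperIncrNeg l p T (k + 1) := by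
  have hl := h.rate_pos
  have h1 := h.pair_pos (k + 1)
  have h2 := h.pair_pos k
  have h2' := h.prev_pair_pos k
  have h3 := h.pair_le hk
  have h4 := h.pair_le (k := k + 1) (by omega)
  have h5 := h.div_nonneg_of_nonneg hk
  have h6 := h.pair_sub (k + 1)
  have h7 := h.tail_sub (k + 1)
  have h8 := h.tail_nonneg (k + 1)
  have h9 := h.pos (k + 1)
  unfold upperIncrNeg
  rw [add_sub_cancel_right] at *
  set a := p (k - 1) + p k
  set b := p k + p (k + 1)
  set c := p (k + 1) + p (k + 1 + 1)
  set q := (k : ℝ) / l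
  have hq : ((k + 1 : ℤ) : ℝ) / l = q + 1 / l := by
    push_cast; simp only [q]; ring
  rw [hq] at h6 ⊢
  have hT : T k = T (k + 1) + p (k + 1) := by linarith
  rw [hT]
  have hl' : 0 < 1 / l := by positivity
  generalize 1 / l = r at *
  generalize T (k + 1) = t at *
  generalize p (k + 1) = w at *
  -- Only the tail factor decreases, by `w = p (k + 1)`; the gain `1 / c - 1 / b` of the first
  -- summand pays for that loss (`e2`).
  have e1 : 1 / c - 1 / b = (q + r) * w / (c * b) := by
    rw [← h6]; field_simp
  have e2 : q * w / (b * a) ≤ (q + r) * w / (c * b) := by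
    rw [mul_comm b a]
    gcongr
    · linarith
    · linarith
  have e3 : q * t / (b * a) ≤ (q + r) * t / (c * b) := by
    rw [mul_comm b a]
    gcongr
    · linarith
    · linarith
  have e4 : q * (t + w) / (b * a) = q * t / (b * a) + q * w / (b * a) := by ring
  linarith

theorem mul_upperIncrPos_le (h : IsSteinWeight l p T) {k : ℤ} (hk : 0 ≤ k) :
    (p k + p (k + 1)) * upperIncrPos p k ≤ 2 := by
  have h1 := h.pair_pos k
  have h2 := h.prev_pair_pos k
  have h3 := h.pair_le hk
  have h4 : (p k + p (k + 1)) / (p (k - 1) + p k) ≤ 1 := (div_le_one h2).2 h3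
  have h5 : (p k + p (k + 1)) / (p k + p (k + 1)) = 1 := div_self h1.ne'
  unfold upperIncrPos
  rw [mul_add, mul_one_div, mul_one_div]
  linarith

theorem upperIncrNeg_le_upperIncrPos (h : IsSteinWeight l p T) (k : ℤ) :
    upperIncrNeg l p T k ≤ upperIncrPos p k := by
  have h1 := h.pair_pos k
  have h2 := h.prev_pair_pos k
  have h3 := h.div_mul_tail_le k
  have h4 : k / l * T k / ((p k + p (k + 1)) * (p (k - 1) + p k)) ≤ 1 / (p (k - 1) + p k) := by
    rw [div_le_div_iff₀ (by positivity) h2]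
    nlinarith
  unfold upperIncrPos upperIncrNeg
  linarith

/-- The factor `T k` absorbs the growing `k / l` through `div_mul_tail_le`; each of the two summands
is then at most `1`. -/
theorem mul_lowerIncr_le (h : IsSteinWeight l p T) {k : ℤ} (hk : 0 ≤ k) :
    T k * ((p k + p (k + 1)) * lowerIncr l p T k) ≤ 2 := by
  have h1 := h.pair_pos k
  have h2 := h.prev_pair_pos k
  have h3 := h.pair_le hk
  have h4 := (h.div_mul_tail_le k).trans h3
  have h5 := h.tail_le_one k
  have h6 := h.tail_nonneg (k - 1)
  have h7 := h.tail_le_one (k - 1)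
  have h8 := mul_nonneg (h.div_nonneg_of_nonneg hk) (h.tail_nonneg k)
  have e : T k * ((p k + p (k + 1)) * lowerIncr l p T k) =
      T k + (k / l * T k) * (1 - T (k - 1)) / (p (k - 1) + p k) := by
    unfold lowerIncr
    field_simp
  have h9 : (k / l * T k) * (1 - T (k - 1)) / (p (k - 1) + p k) ≤ 1 := by
    rw [div_le_one h2]
    nlinarith
  linarith

theorem flux_incr_of_le (h : IsSteinWeight l p T) {m k : ℤ} (hk : k ≤ m) :
    steinFlux T m k / (p k + p (k + 1)) - steinFlux T m (k - 1) / (p (k - 1) + p k) =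
      p k * (T m * lowerIncr l p T k) := by
  have h1 := h.pair_pos k
  have h2 := h.prev_pair_pos k
  have h3 := h.pair_sub k
  have h4 := h.tail_sub k
  unfold steinFlux lowerIncr
  rw [min_eq_left hk, max_eq_right hk, min_eq_left (by omega), max_eq_right (by omega)]
  set a := p (k - 1) + p k
  set b := p k + p (k + 1)
  rw [show T k = T (k - 1) - p k by linarith]
  field_simp
  linear_combination T m * (1 - T (k - 1)) * h3

theorem flux_incr_of_lt (h : IsSteinWeight l p T) {m k : ℤ} (hk : m < k) :
    steinFlux T m k / (p k + p (k + 1)) - steinFlux T m (k - 1) / (p (k - 1) + p k) =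
      -(p k * ((1 - T m) * (upperIncrPos p k - upperIncrNeg l p T k))) := by
  have h1 := h.pair_pos k
  have h2 := h.prev_pair_pos k
  have h3 := h.pair_sub k
  have h4 := h.tail_sub k
  unfold steinFlux upperIncrPos upperIncrNeg
  rw [min_eq_right hk.le, max_eq_left hk.le, min_eq_right (by omega), max_eq_left (by omega)]
  set a := p (k - 1) + p k
  set b := p k + p (k + 1)
  rw [show T (k - 1) = T k + p k by linarith]
  field_simp
  linear_combination (1 - T m) * T k * h3

/-! ### The alternating recursion and the bound on differences. -/

/-- Scaled differences of a solution of the first-order equation satisfy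
`e_k + e_{k-1} = ρ_k`. -/
theorem scaled_diff_add (h : IsSteinWeight l p T) {m : ℤ} {f : ℤ → ℝ}
    (hf : ∀ k, l * (p k * f (k + 1) + p (k + 1) * f k) = steinFlux T m k) (k : ℤ) :
    p k * l * ((f (k + 1) - f k) / (p k + p (k + 1)) +
        (f k - f (k - 1)) / (p (k - 1) + p k)) =
      steinFlux T m k / (p k + p (k + 1)) - steinFlux T m (k - 1) / (p (k - 1) + p k) := by
  have h1 := h.pair_pos k
  have h2 := h.prev_pair_pos k
  have h3 := hf (k - 1)
  rw [sub_add_cancel] at h3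
  rw [← h3, ← hf k]
  field_simp
  ring

/-- Beyond `m`, `x` and `y` follow the alternating recursion for the two monotone parts, while `z`
is the value inherited from `m`, which only changes sign. Since the pair sums decrease, the bound on
`|z|` times the pair sum persists. -/
theorem scaled_diff_bound (h : IsSteinWeight l p T) {m : ℤ} {f : ℤ → ℝ}
    (hf : ∀ k, l * (p k * f (k + 1) + p (k + 1) * f k) = steinFlux T m k)
    (h0 : 2 * f 0 = f 1 + f (-1)) (n : ℕ) :
    ((n : ℤ) ≤ m → 0 ≤ l * ((f (n + 1) - f n) / (p n + p (n + 1))) ∧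
      l * ((f (n + 1) - f n) / (p n + p (n + 1))) ≤ T m * lowerIncr l p T n) ∧
    (m ≤ n → ∃ x y z, 0 ≤ x ∧ x ≤ upperIncrPos p n ∧ 0 ≤ y ∧ y ≤ upperIncrNeg l p T n ∧
      |z| * (p n + p (n + 1)) ≤ 2 ∧
      l * ((f (n + 1) - f n) / (p n + p (n + 1))) = z + (1 - T m) * (y - x)) := by
  have hTm := h.tail_nonneg m
  have hcancel : ∀ k u v, p k * l * u = p k * v → l * u = v := fun k u v huv =>
    mul_left_cancel₀ (h.pos k).ne' (by linarith)
  -- At the jump the whole accumulated value becomes `z`, with `x = y = 0`.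
  have switch : ∀ n : ℕ, (n : ℤ) = m →
      (0 ≤ l * ((f (n + 1) - f n) / (p n + p (n + 1))) ∧
        l * ((f (n + 1) - f n) / (p n + p (n + 1))) ≤ T m * lowerIncr l p T n) →
      ∃ x y z, 0 ≤ x ∧ x ≤ upperIncrPos p n ∧ 0 ≤ y ∧ y ≤ upperIncrNeg l p T n ∧
        |z| * (p n + p (n + 1)) ≤ 2 ∧
        l * ((f (n + 1) - f n) / (p n + p (n + 1))) = z + (1 - T m) * (y - x) := by
    rintro n rfl ⟨ha, hb⟩
    refine ⟨0, 0, _, le_rfl, h.upperIncrPos_nonneg _, le_rfl,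
      h.upperIncrNeg_nonneg (Int.natCast_nonneg n), ?_, (by rw [sub_self, mul_zero, add_zero])⟩
    rw [abs_of_nonneg ha]
    have h1 := h.mul_lowerIncr_le (Int.natCast_nonneg n)
    have h2 := mul_le_mul_of_nonneg_right hb (h.pair_pos n).le
    linarith
  induction n with
  | zero =>
    have hs := h.scaled_diff_add hf 0
    -- Evenness of `p` and `h0` make the scaled differences at `-1` and `0` equal, so each is half
    -- the right-hand side.
    have he : (f 0 - f (0 - 1)) / (p (0 - 1) + p 0) = (f (0 + 1) - f 0) / (p 0 + p (0 + 1)) := by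
      have h1 := h.even 1
      simp only [zero_sub, zero_add]
      rw [h1, add_comm (p 1), show f 0 - f (-1) = f 1 - f 0 by linarith]
    rw [he, ← two_mul] at hs
    have first : (0 : ℤ) ≤ m → 0 ≤ l * ((f (0 + 1) - f 0) / (p 0 + p (0 + 1))) ∧
        l * ((f (0 + 1) - f 0) / (p 0 + p (0 + 1))) ≤ T m * lowerIncr l p T 0 := by
      intro hm
      rw [h.flux_incr_of_le hm] at hs
      have h1 := hcancel _ _ _ hs
      have h2 := mul_nonneg hTm (h.lowerIncr_nonneg le_rfl)
      constructor <;> linarith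
    refine ⟨by simpa using first, fun hm => ?_⟩
    rcases eq_or_lt_of_le hm with hm | hm
    · exact switch 0 hm.symm (by simpa using first (by simpa using hm.ge))
    · have hm' : m < 0 := by simpa using hm
      rw [h.flux_incr_of_lt hm', ← mul_neg] at hs
      have h1 := hcancel _ _ _ hs
      have h2 := h.upperIncrPos_nonneg 0
      have h3 := h.upperIncrNeg_nonneg (le_refl (0 : ℤ))
      refine ⟨upperIncrPos p 0 / 2, upperIncrNeg l p T 0 / 2, 0, by linarith, ?_, by linarith,
        ?_, by simp, ?_⟩
      · simp only [Nat.cast_zero]; linarith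
      · simp only [Nat.cast_zero]; linarith
      · simp only [Nat.cast_zero]; linarith
  | succ n ih =>
    have hn : (0 : ℤ) ≤ n := Int.natCast_nonneg n
    have hs := h.scaled_diff_add hf (n + 1)
    push_cast
    rw [add_sub_cancel_right] at hs
    have first : (n + 1 : ℤ) ≤ m →
        0 ≤ l * ((f (n + 1 + 1) - f (n + 1)) / (p (n + 1) + p (n + 1 + 1))) ∧
        l * ((f (n + 1 + 1) - f (n + 1)) / (p (n + 1) + p (n + 1 + 1))) ≤
          T m * lowerIncr l p T (n + 1) := by
      intro hm
      obtain ⟨ha, hb⟩ := ih.1 (by omega)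
      have h4 := h.flux_incr_of_le hm
      rw [add_sub_cancel_right] at h4
      rw [h4] at hs
      have h1 := hcancel _ _ _ hs
      have h2 := mul_le_mul_of_nonneg_left (h.lowerIncr_le_succ hn) hTm
      constructor <;> linarith
    refine ⟨first, fun hm => ?_⟩
    rcases eq_or_lt_of_le hm with hm | hm
    · have := switch (n + 1) (by push_cast; omega)
      push_cast at this
      exact this (first (by omega))
    · obtain ⟨x, y, z, hx0, hx, hy0, hy, hz, he⟩ := ih.2 (by omega)
      have h4 := h.flux_incr_of_lt hm
      rw [add_sub_cancel_right] at h4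
      rw [h4, ← mul_neg] at hs
      have h1 := hcancel _ _ _ hs
      have h2 := h.upperIncrPos_le_succ hn
      have h3 := h.upperIncrNeg_le_succ hn
      have h5 := h.pair_le (k := n + 1) (by omega)
      rw [add_sub_cancel_right] at h5
      refine ⟨upperIncrPos p (n + 1) - x, upperIncrNeg l p T (n + 1) - y, -z, by linarith,
        by linarith, by linarith, by linarith, ?_, by linarith⟩
      rw [abs_neg]
      exact (mul_le_mul_of_nonneg_left h5 (abs_nonneg z)).trans hz

theorem abs_diff_le_of_nonneg (h : IsSteinWeight l p T) {m : ℤ} {f : ℤ → ℝ}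
    (hf : ∀ k, l * (p k * f (k + 1) + p (k + 1) * f k) = steinFlux T m k)
    (h0 : 2 * f 0 = f 1 + f (-1)) {k : ℤ} (hk : 0 ≤ k) :
    |f (k + 1) - f k| ≤ 4 / l := by
  lift k to ℕ using hk
  have hl := h.rate_pos
  have hs := h.pair_pos k
  have hk : (0 : ℤ) ≤ k := Int.natCast_nonneg k
  obtain ⟨ha, hb⟩ := h.scaled_diff_bound hf h0 k
  have e : f (k + 1) - f k = l * ((f (k + 1) - f k) / (p k + p (k + 1))) *
      (p k + p (k + 1)) / l := by
    field_simp
  rw [e, abs_div, abs_of_pos hl]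
  gcongr
  rw [abs_mul, abs_of_pos hs]
  rcases le_total (k : ℤ) m with hm | hm
  · obtain ⟨h1, h2⟩ := ha hm
    rw [abs_of_nonneg h1]
    have h3 := h.mul_lowerIncr_le hk
    have h4 := mul_le_mul_of_nonneg_right (h.antitone_tail hm) (h.lowerIncr_nonneg hk)
    have h5 := mul_le_mul_of_nonneg_right (h2.trans h4) hs.le
    linarith
  · obtain ⟨x, y, z, hx0, hx, hy0, hy, hz, he⟩ := hb hm
    rw [he]
    have h1 := h.tail_nonneg m
    have h2 := h.tail_le_one m
    have h3 : |y - x| ≤ upperIncrPos p k := by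
      have := h.upperIncrNeg_le_upperIncrPos k
      rw [abs_le]; constructor <;> linarith
    have h4 : |(1 - T m) * (y - x)| ≤ upperIncrPos p k := by
      rw [abs_mul, abs_of_nonneg (by linarith)]
      nlinarith [abs_nonneg (y - x)]
    -- The constant `4` is `2` from the inherited `z` plus `2` from `upperIncrPos`.
    have h5 := mul_le_mul_of_nonneg_right ((abs_add_le z _).trans (add_le_add_right h4 |z|)) hs.le
    have h6 := h.mul_upperIncrPos_le hk
    linarith

theorem abs_diff_le (h : IsSteinWeight l p T) {m : ℤ} {f : ℤ → ℝ}
    (hf : ∀ k, l * (p k * f (k + 1) + p (k + 1) * f k) = steinFlux T m k)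
    (h0 : 2 * f 0 = f 1 + f (-1)) (k : ℤ) :
    |f (k + 1) - f k| ≤ 4 / l := by
  rcases le_or_gt 0 k with hk | hk
  · exact h.abs_diff_le_of_nonneg hf h0 hk
  -- The reflected function solves the first-order equation with its jump moved to `-m - 1`.
  · have h1 := h.abs_diff_le_of_nonneg (m := -m - 1) (f := fun k => f (-k)) (k := -k - 1)
      (fun j => ?_) ?_ (by omega)
    · rw [show -(-k - 1 + 1) = k by ring, show -(-k - 1) = k + 1 by ring, abs_sub_comm] at h1
      exact h1
    · rw [← h.steinFlux_reflect, ← hf, show -j - 1 + 1 = -j by ring, h.even,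
        show -j - 1 = -(j + 1) by ring, h.even]
      ring
    · simp only [neg_zero, neg_neg]
      linarith

theorem flux_div_le (h : IsSteinWeight l p T) (m k : ℤ) :
    steinFlux T m k / (p k + p (k + 1)) ≤ l + 1 / (p 0 + p 1) := by
  have key : ∀ m k : ℤ, 0 ≤ k →
      steinFlux T m k / (p k + p (k + 1)) ≤ l + 1 / (p 0 + p 1) := by
    intro m k hk
    have hl := h.rate_pos
    have h1 := h.pair_pos k
    have h2 := h.steinFlux_le_tail m k
    have h3 := h.pair_pos 0
    rw [zero_add] at h3
    rcases hk.eq_or_lt with rfl | hk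
    · have h4 := h2.trans (h.tail_le_one 0)
      rw [zero_add]
      have : steinFlux T m 0 / (p 0 + p 1) ≤ 1 / (p 0 + p 1) := by gcongr
      linarith
    · have h4 : (1 : ℝ) ≤ k := by exact_mod_cast hk
      have h5 := h.mul_tail_le k
      have h6 := h.tail_nonneg k
      have : steinFlux T m k / (p k + p (k + 1)) ≤ l := by
        rw [div_le_iff₀ h1]
        nlinarith
      have : 0 < 1 / (p 0 + p 1) := by positivity
      linarith
  rcases le_or_gt 0 k with hk | hk
  · exact key m k hk
  · have h1 := key (-m - 1) (-k - 1) (by omega)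
    rw [← h.steinFlux_reflect, show -(-k - 1) - 1 = k by ring, show -k - 1 + 1 = -k by ring,
      h.even, show -k - 1 = -(k + 1) by ring, h.even, add_comm (p (k + 1))] at h1
    exact h1

theorem bounded_of_flux (h : IsSteinWeight l p T) {m : ℤ} {f : ℤ → ℝ}
    (hf : ∀ k, l * (p k * f (k + 1) + p (k + 1) * f k) = steinFlux T m k)
    (h0 : 2 * f 0 = f 1 + f (-1)) : ∃ C, ∀ k, |f k| ≤ C := by
  refine ⟨(l + 1 / (p 0 + p 1)) / l + 4 / l, fun k => ?_⟩
  have hl := h.rate_pos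
  have hs := h.pair_pos k
  have hp := h.pos k
  have hp' := h.pos (k + 1)
  have h1 := h.flux_div_le m k
  have h2 := h.abs_diff_le hf h0 k
  have h3 := div_nonneg (h.steinFlux_nonneg m k) hs.le
  -- The first-order equation fixes a weighted mean of `f k` and `f (k + 1)`, so a bound on
  -- differences bounds `f` itself.
  have e : f k = steinFlux T m k / (p k + p (k + 1)) / l -
      p k / (p k + p (k + 1)) * (f (k + 1) - f k) := by
    rw [← hf k]
    field_simp
    ring
  have h4 : p k / (p k + p (k + 1)) ≤ 1 := (div_le_one hs).2 (by linarith)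
  have h5 : |p k / (p k + p (k + 1)) * (f (k + 1) - f k)| ≤ 4 / l := by
    rw [abs_mul, abs_of_pos (by positivity)]
    nlinarith [abs_nonneg (f (k + 1) - f k)]
  have h6 : |steinFlux T m k / (p k + p (k + 1)) / l| ≤ (l + 1 / (p 0 + p 1)) / l := by
    rw [abs_of_nonneg (by positivity)]
    gcongr
  rw [e]
  exact (abs_sub _ _).trans (add_le_add h6 h5)

end IsSteinWeight

/-! ### Bessel functions: generating sum, positivity and recurrence. -/

/-- The natural number pairs `(a, b)` with `a - b = n` are `(k + n⁺, k + n⁻)`, `k ∈ ℕ`. -/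
def diffMinEquiv : ℤ × ℕ ≃ ℕ × ℕ where
  toFun q := (q.2 + q.1.toNat, q.2 + (-q.1).toNat)
  invFun r := ((r.1 : ℤ) - r.2, min r.1 r.2)
  left_inv := by rintro ⟨n, k⟩; ext <;> simp; omega
  right_inv := by rintro ⟨a, b⟩; ext <;> simp <;> omega

theorem hasSum_exp_mul_exp (y : ℝ) (hy : 0 ≤ y) :
    HasSum (fun r : ℕ × ℕ => y ^ r.1 / (r.1.factorial : ℝ) * (y ^ r.2 / (r.2.factorial : ℝ)))
      (Real.exp (2 * y)) := by
  have h : HasSum (fun n : ℕ => y ^ n / (n.factorial : ℝ)) (Real.exp y) := by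
    rw [Real.exp_eq_exp_ℝ]
    exact NormedSpace.expSeries_div_hasSum_exp y
  rw [two_mul, Real.exp_add]
  exact h.mul h (h.summable.mul_of_nonneg h.summable (fun n => by positivity)
    (fun n => by positivity))

/-- The double series for `exp y * exp y`, regrouped by the difference of the two exponents. -/
theorem hasSum_besselI_terms (y : ℝ) (hy : 0 ≤ y) :
    HasSum (fun q : ℤ × ℕ => y ^ (2 * q.2 + q.1.natAbs) /
      ((q.2.factorial : ℝ) * ((q.2 + q.1.natAbs).factorial : ℝ))) (Real.exp (2 * y)) := by
  refine ((diffMinEquiv.hasSum_iff).2 (hasSum_exp_mul_exp y hy)).congr_fun ?_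
  rintro ⟨n, k⟩
  simp only [Function.comp, diffMinEquiv, Equiv.coe_fn_mk]
  rw [div_mul_div_comm, ← pow_add]
  rcases le_total 0 n with hn | hn
  · have h1 : n.toNat = n.natAbs := by omega
    have h2 : (-n).toNat = 0 := by omega
    rw [h1, h2, add_zero, mul_comm (k.factorial : ℝ)]
    congr 2
    omega
  · have h1 : (-n).toNat = n.natAbs := by omega
    have h2 : n.toNat = 0 := by omega
    rw [h1, h2, add_zero]
    congr 2
    omega

theorem hasSum_besselI (n : ℤ) (y : ℝ) (hy : 0 ≤ y) :
    HasSum (fun k : ℕ => y ^ (2 * k + n.natAbs) /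
      ((k.factorial : ℝ) * ((k + n.natAbs).factorial : ℝ))) (besselI n (2 * y)) := by
  have h := ((hasSum_besselI_terms y hy).summable.prod_factor n).hasSum
  simpa only [besselI, mul_div_cancel_left₀ y (two_ne_zero' ℝ)] using h

theorem hasSum_int_besselI (y : ℝ) (hy : 0 ≤ y) :
    HasSum (fun n : ℤ => besselI n (2 * y)) (Real.exp (2 * y)) :=
  (hasSum_besselI_terms y hy).prod_fiberwise fun n => hasSum_besselI n y hy

theorem besselI_pos (n : ℤ) (y : ℝ) (hy : 0 < y) : 0 < besselI n (2 * y) := by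
  have h := hasSum_besselI n y hy.le
  rw [← h.tsum_eq]
  exact h.summable.tsum_pos (fun k => by positivity) 0 (by positivity)

theorem besselI_neg (n : ℤ) (z : ℝ) : besselI (-n) z = besselI n z := by
  simp only [besselI, Int.natAbs_neg]

/-- Termwise this is `(k + n + 1) - k = n + 1`, once the series of order `n + 2` is shifted by one
index; the added term at `k = 0` vanishes. -/
theorem besselI_recurrence_nat (n : ℕ) (y : ℝ) (hy : 0 ≤ y) :
    y * (besselI n (2 * y) - besselI (n + 2) (2 * y)) = (n + 1) * besselI (n + 1) (2 * y) := by
  have h0 := (hasSum_besselI n y hy).mul_left y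
  have h1 := (hasSum_besselI (n + 1) y hy).mul_left ((n : ℝ) + 1)
  have h2 := (hasSum_besselI (n + 2) y hy).mul_left y
  simp only [show ((n : ℤ) + 2).natAbs = n + 2 by omega,
    show ((n : ℤ) + 1).natAbs = n + 1 by omega, Int.natAbs_natCast] at h0 h1 h2
  have h3 : HasSum (fun k : ℕ => (k : ℝ) * (y ^ (2 * k + (n + 1)) /
      ((k.factorial : ℝ) * ((k + (n + 1)).factorial : ℝ)))) (y * besselI (n + 2) (2 * y)) := by
    rw [← hasSum_nat_add_iff' 1]
    simp only [Finset.range_one, Finset.sum_singleton, Nat.cast_zero, zero_mul, sub_zero]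
    refine h2.congr_fun fun k => ?_
    rw [show k + 1 + (n + 1) = k + (n + 2) by ring,
      show 2 * (k + 1) + (n + 1) = 2 * k + (n + 2) + 1 by ring, pow_succ, Nat.factorial_succ k]
    push_cast
    have := Nat.factorial_ne_zero k
    field_simp
  have h4 := (h0.sub h3).unique (h1.congr_fun fun k => ?_)
  · linarith
  · rw [show k + (n + 1) = (k + n) + 1 by ring,
      show 2 * k + (n + 1) = 2 * k + n + 1 by ring, pow_succ, Nat.factorial_succ (k + n)]
    push_cast
    field_simp
    ring

theorem besselI_recurrence (k : ℤ) (y : ℝ) (hy : 0 ≤ y) :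
    y * (besselI (k - 1) (2 * y) - besselI (k + 1) (2 * y)) = k * besselI k (2 * y) := by
  rcases lt_trichotomy k 0 with hk | rfl | hk
  · obtain ⟨n, hn⟩ := Int.eq_ofNat_of_zero_le (show 0 ≤ -k - 1 by omega)
    have h := besselI_recurrence_nat n y hy
    have e : k = -((n : ℤ) + 1) := by omega
    rw [e, show -((n : ℤ) + 1) - 1 = -(n + 2) by ring, show -((n : ℤ) + 1) + 1 = -n by ring,
      besselI_neg, besselI_neg, besselI_neg]
    push_cast
    linarith
  · rw [zero_sub, zero_add, besselI_neg]
    simp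
  · obtain ⟨n, hn⟩ := Int.eq_ofNat_of_zero_le (show 0 ≤ k - 1 by omega)
    have h := besselI_recurrence_nat n y hy
    have e : k = (n : ℤ) + 1 := by omega
    rw [e, add_sub_cancel_right, show (n : ℤ) + 1 + 1 = n + 2 by ring, h]
    push_cast
    ring

/-! ### The symmetric Skellam law as a Stein weight. -/

theorem skellamProb_self {l : ℝ} (hl : 0 < l) (k : ℤ) :
    skellamProb l l k = Real.exp (-(2 * l)) * besselI k (2 * l) := by
  rw [skellamProb, div_self hl.ne', Real.sqrt_one, one_zpow, mul_one, Real.sqrt_mul_self hl.le,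
    two_mul]

theorem skellamProb_self_pos {l : ℝ} (hl : 0 < l) (k : ℤ) : 0 < skellamProb l l k := by
  rw [skellamProb_self hl]
  exact mul_pos (Real.exp_pos _) (besselI_pos k l hl)

theorem hasSum_skellamProb_self {l : ℝ} (hl : 0 < l) : HasSum (skellamProb l l) 1 := by
  have h := (hasSum_int_besselI l hl.le).mul_left (Real.exp (-(2 * l)))
  rw [← Real.exp_add, neg_add_cancel, Real.exp_zero] at h
  exact h.congr_fun fun k => skellamProb_self hl k

theorem isProbabilityMeasure_skellamMeasure {l : ℝ} (hl : 0 < l) :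
    IsProbabilityMeasure (skellamMeasure l l) :=
  (hasSum_skellamProb_self hl).isProbabilityMeasure_sum_dirac
    (fun k => (skellamProb_self_pos hl k).le)

theorem skellamMeasure_real_singleton {l : ℝ} (hl : 0 < l) (k : ℤ) :
    (skellamMeasure l l).real {k} = skellamProb l l k := by
  rw [Measure.real, skellamMeasure, Measure.sum_smul_dirac_singleton,
    ENNReal.toReal_ofReal (skellamProb_self_pos hl k).le]

theorem setOf_intCast_le (x : ℝ) : {k : ℤ | (k : ℝ) ≤ x} = Set.Iic ⌊x⌋ := by
  ext k; simp [Int.le_floor]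

theorem setOf_lt_intCast (x : ℝ) : {k : ℤ | x < (k : ℝ)} = Set.Ioi ⌊x⌋ := by
  ext k; simp [Int.floor_lt]

theorem skellamTail_floor (l x : ℝ) : skellamTail l l x = skellamTail l l (⌊x⌋ : ℤ) := by
  rw [skellamTail, skellamTail, setOf_lt_intCast, setOf_lt_intCast, Int.floor_intCast]

theorem skellamCDF_eq {l : ℝ} (hl : 0 < l) (x : ℝ) :
    skellamCDF l l x = 1 - skellamTail l l (⌊x⌋ : ℤ) := by
  have := isProbabilityMeasure_skellamMeasure hl
  rw [skellamCDF, skellamTail, setOf_intCast_le, setOf_lt_intCast, Int.floor_intCast,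
    ← Set.compl_Iic, measureReal_compl measurableSet_Iic]
  simp

theorem skellamMeasure_real_neg_preimage {l : ℝ} (hl : 0 < l) (s : Set ℤ) :
    (skellamMeasure l l).real ((fun k => -k) ⁻¹' s) = (skellamMeasure l l).real s := by
  have e : ∀ k : ℤ, skellamProb l l (-k) = skellamProb l l k := fun k => by
    rw [skellamProb_self hl, skellamProb_self hl, besselI_neg]
  rw [Measure.real, Measure.real]
  congr 1
  rw [skellamMeasure, Measure.sum_apply _ (by trivial), Measure.sum_apply _ (by trivial),
    ← (Equiv.neg ℤ).tsum_eq]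
  refine tsum_congr fun k => ?_
  simp only [Equiv.neg_apply, e, Measure.smul_apply, Measure.dirac_apply, Set.indicator,
    Pi.one_apply]
  have hm : -k ∈ (fun k => -k) ⁻¹' s ↔ k ∈ s := by
    change -(-k) ∈ s ↔ k ∈ s
    rw [neg_neg]
  by_cases hs : k ∈ s
  · rw [if_pos (hm.2 hs), if_pos hs]
  · rw [if_neg (mt hm.1 hs), if_neg hs]

theorem isSteinWeight_skellam {l : ℝ} (hl : 0 < l) :
    IsSteinWeight l (skellamProb l l) (fun k : ℤ => skellamTail l l k) := by
  have := isProbabilityMeasure_skellamMeasure hl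
  refine ⟨hl, skellamProb_self_pos hl, fun k => ?_, fun k => ?_, fun k => ?_, fun k => ?_,
    fun k => ?_, ?_⟩
  · rw [skellamProb_self hl, skellamProb_self hl, besselI_neg]
  · have h := besselI_recurrence k l hl.le
    simp only [skellamProb_self hl]
    linear_combination Real.exp (-(2 * l)) * h
  · simp only [skellamTail, setOf_lt_intCast, Int.floor_intCast]
    rw [← skellamMeasure_real_singleton hl,
      show Set.Ioi (k - 1) = Set.Ioi k ∪ {k} by
        ext j; simp only [Set.mem_Ioi, Set.mem_union, Set.mem_singleton_iff]; omega,
      measureReal_union (by simp) (by trivial)]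
    ring
  · exact measureReal_nonneg
  · simp only [skellamTail, setOf_lt_intCast, Int.floor_intCast]
    rw [← skellamMeasure_real_neg_preimage hl (Set.Ioi (-k - 1)),
      show (fun k : ℤ => -k) ⁻¹' Set.Ioi (-k - 1) = (Set.Ioi k)ᶜ by
        ext j; simp only [Set.mem_preimage, Set.mem_Ioi, Set.mem_compl_iff]; omega,
      measureReal_compl (by trivial)]
    simp
  · simp only [skellamTail, setOf_lt_intCast, Int.floor_intCast]
    have h := tendsto_measure_iInter_atTop (μ := skellamMeasure l l)
      (s := fun k : ℤ => Set.Ioi k) (fun k => measurableSet_Ioi.nullMeasurableSet)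
      (fun a b hab => Set.Ioi_subset_Ioi hab) ⟨0, measure_ne_top _ _⟩
    rw [show (⋂ k : ℤ, Set.Ioi k) = ∅ by
      ext j; simp only [Set.mem_iInter, Set.mem_Ioi, Set.mem_empty_iff_false, iff_false]
      exact fun hj => lt_irrefl j (hj j), measure_empty] at h
    exact (ENNReal.tendsto_toReal ENNReal.zero_ne_top).comp h

/-! ### Existence and uniqueness of solutions. -/

/-- Every function on `ℤ` has an antidifference with prescribed value at `0`. -/
theorem exists_int_antidifference (g : ℤ → ℝ) (c : ℝ) :
    ∃ v : ℤ → ℝ, v 0 = c ∧ ∀ k, v (k + 1) - v k = g k := by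
  refine ⟨fun k => c + ∑ i ∈ Finset.range k.toNat, g i -
    ∑ i ∈ Finset.range (-k).toNat, g (-i - 1), by simp, fun k => ?_⟩
  beta_reduce
  rcases le_or_gt 0 k with hk | hk
  · lift k to ℕ using hk
    rw [show ((k : ℤ) + 1).toNat = k + 1 by omega, show (-((k : ℤ) + 1)).toNat = 0 by omega,
      show (-(k : ℤ)).toNat = 0 by omega, Int.toNat_natCast, Finset.sum_range_succ]
    simp
  · obtain ⟨n, hn⟩ := Int.eq_ofNat_of_zero_le (show 0 ≤ -k - 1 by omega)
    have e : k = -(n : ℤ) - 1 := by omega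
    subst e
    rw [show (-(-(n : ℤ) - 1 + 1)).toNat = n by omega,
      show (-(-(n : ℤ) - 1)).toNat = n + 1 by omega,
      show (-(n : ℤ) - 1 + 1).toNat = 0 by omega,
      show (-(n : ℤ) - 1).toNat = 0 by omega, Finset.sum_range_succ]
    simp

namespace IsSteinWeight

variable {l : ℝ} {p T : ℤ → ℝ}

theorem exists_flux_solution (h : IsSteinWeight l p T) (m : ℤ) (c : ℝ) :
    ∃ f : ℤ → ℝ, f 0 = c ∧
      ∀ k, l * (p k * f (k + 1) + p (k + 1) * f k) = steinFlux T m k := by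
  -- Variation of constants: `(-1) ^ k * p k` solves the homogeneous first-order equation.
  obtain ⟨v, hv0, hv⟩ := exists_int_antidifference
    (fun k => (-1) ^ (k + 1) * steinFlux T m k / (l * p k * p (k + 1))) (c / p 0)
  refine ⟨fun k => (-1) ^ k * p k * v k, ?_, fun k => ?_⟩
  · have := h.pos 0
    beta_reduce
    rw [hv0, zpow_zero]
    field_simp
  · have hl := h.rate_pos
    have h1 := h.pos k
    have h2 := h.pos (k + 1)
    have h3 := hv k
    rw [eq_div_iff (by positivity)] at h3
    have h4 : ((-1 : ℝ) ^ k) * (-1) ^ k = 1 := by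
      rw [← mul_zpow]; norm_num
    beta_reduce
    rw [zpow_add_one₀ (by norm_num)] at h3 ⊢
    linear_combination (-(-1) ^ k) * h3 + steinFlux T m k * h4

theorem steinOp_mul (h : IsSteinWeight l p T) (f : ℤ → ℝ) (k : ℤ) :
    p k * steinOp l l f k = l * (p k * f (k + 1) + p (k + 1) * f k) -
      l * (p (k - 1) * f k + p k * f (k - 1)) := by
  unfold steinOp
  linear_combination f k * h.recurrence k

/-- Bounded solutions of the Stein equation are determined by their value at `0`. -/
theorem solution_unique (h : IsSteinWeight l p T) {f g : ℤ → ℝ}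
    (hf : ∃ C, ∀ k, |f k| ≤ C) (hg : ∃ C, ∀ k, |g k| ≤ C)
    (heq : ∀ k, steinOp l l f k = steinOp l l g k) (h0 : f 0 = g 0) : f = g := by
  have hl := h.rate_pos
  obtain ⟨C, hC⟩ := hf
  obtain ⟨D, hD⟩ := hg
  set d : ℤ → ℝ := fun k => f k - g k with hd
  have hdb : ∀ k, |d k| ≤ C + D := fun k => (abs_sub _ _).trans (add_le_add (hC k) (hD k))
  -- `Q` is constant by telescoping and tends to `0` because `d` is bounded; hence `Q = 0`, and `d 0
  -- = 0` propagates in both directions.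
  let Q : ℤ → ℝ := fun k => p k * d (k + 1) + p (k + 1) * d k
  have hQ : ∀ k, Q k = Q (k - 1) := fun k => by
    have h1 := h.steinOp_mul f k
    have h2 := h.steinOp_mul g k
    rw [heq k, h2] at h1
    apply mul_left_cancel₀ hl.ne'
    simp only [Q, hd, sub_add_cancel]
    linarith
  have hQ0 : ∀ k, Q k = Q 0 := fun k => by
    induction k using Int.induction_on with
    | zero => rfl
    | succ n ih => rw [hQ, add_sub_cancel_right, ih]
    | pred n ih => rw [← hQ, ih]
  have hlim : Filter.Tendsto (fun n : ℕ => Q n) Filter.atTop (nhds 0) := by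
    have hp : Filter.Tendsto (fun n : ℕ => p n) Filter.atTop (nhds 0) :=
      h.tendsto_zero.comp tendsto_natCast_atTop_atTop
    have hp1 : Filter.Tendsto (fun n : ℕ => p (n + 1)) Filter.atTop (nhds 0) :=
      h.tendsto_zero.comp
        (Filter.tendsto_atTop_add_const_right _ 1 tendsto_natCast_atTop_atTop)
    refine squeeze_zero_norm (a := fun n : ℕ => (p n + p (n + 1)) * (C + D)) (fun n => ?_) ?_
    · rw [Real.norm_eq_abs, add_mul]
      refine (abs_add_le _ _).trans (add_le_add ?_ ?_)
      · rw [abs_mul, abs_of_pos (h.pos _)]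
        exact mul_le_mul_of_nonneg_left (hdb _) (h.pos _).le
      · rw [abs_mul, abs_of_pos (h.pos _)]
        exact mul_le_mul_of_nonneg_left (hdb _) (h.pos _).le
    · simpa using (hp.add hp1).mul_const (C + D)
  have hzero : ∀ k, Q k = 0 := fun k => by
    rw [hQ0]
    refine tendsto_nhds_unique ?_ hlim
    simp only [hQ0]
    exact tendsto_const_nhds
  have hd0 : ∀ k, d k = 0 := fun k => by
    induction k using Int.induction_on with
    | zero => simp [hd, h0]
    | succ n ih =>
      have h1 := hzero n
      simp only [Q, ih, mul_zero, add_zero] at h1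
      exact (mul_eq_zero.1 h1).resolve_left (h.pos _).ne'
    | pred n ih =>
      have h1 := hzero (-n - 1)
      simp only [Q, sub_add_cancel, ih, mul_zero, zero_add] at h1
      exact (mul_eq_zero.1 h1).resolve_left (h.pos _).ne'
  exact funext fun k => sub_eq_zero.1 (hd0 k)

end IsSteinWeight

/-! ### Identification of the initial value and conclusion. -/

theorem skellamCDF_mul_skellamTail {l : ℝ} (hl : 0 < l) (k : ℤ) (x : ℝ) :
    skellamCDF l l (min k x) * skellamTail l l (max k x) =
      steinFlux (fun k : ℤ => skellamTail l l k) ⌊x⌋ k := by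
  rw [skellamCDF_eq hl, skellamTail_floor l (max _ _)]
  have h1 : ⌊min (k : ℝ) x⌋ = min k ⌊x⌋ := by
    rw [Int.floor_mono.map_min, Int.floor_intCast]
  have h2 : ⌊max (k : ℝ) x⌋ = max k ⌊x⌋ := by
    rw [Int.floor_mono.map_max, Int.floor_intCast]
  rw [h1, h2, steinFlux]

theorem steinInit_eq {l : ℝ} (hl : 0 < l) (x : ℝ) :
    2 * l * (skellamProb l l 0 + skellamProb l l 1) * steinInit l x =
      steinFlux (fun k : ℤ => skellamTail l l k) ⌊x⌋ 0 +
        steinFlux (fun k : ℤ => skellamTail l l k) ⌊x⌋ (-1) := by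
  have h0 := skellamCDF_mul_skellamTail hl 0 x
  have h1 := skellamCDF_mul_skellamTail hl (-1) x
  push_cast at h0 h1
  rw [← h0, ← h1, steinInit, skellamProb_self hl, skellamProb_self hl, Real.exp_neg]
  have hb := add_pos (besselI_pos 0 l hl) (besselI_pos 1 l hl)
  have := Real.exp_pos (2 * l)
  field_simp

theorem steinTest_eq {l : ℝ} (hl : 0 < l) (x : ℝ) (k : ℤ) :
    steinTest l l x k = (if k ≤ ⌊x⌋ then 1 else 0) - (1 - skellamTail l l (⌊x⌋ : ℤ)) := by
  simp only [steinTest, skellamCDF_eq hl, Int.le_floor]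

theorem exists_steinSolution {l : ℝ} (hl : 0 < l) (x : ℝ) :
    ∃ f : ℤ → ℝ, IsSteinSolution l x f ∧ ∀ k, |f (k + 1) - f k| ≤ 4 / l := by
  have h := isSteinWeight_skellam hl
  obtain ⟨f, hf0, hf⟩ := h.exists_flux_solution ⌊x⌋ (steinInit l x)
  have hp0 := h.pos 0
  -- Adding the first-order equations at `0` and `-1` and comparing with `steinInit_eq` cancels the
  -- `p 1` terms.
  have hsecond : 2 * f 0 = f 1 + f (-1) := by
    have h1 := hf 0
    have h2 := hf (-1)
    have h3 := steinInit_eq hl x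
    have h4 := h.even 1
    rw [← hf0, ← h1, ← h2, h4, neg_add_cancel, zero_add] at h3
    apply mul_left_cancel₀ (mul_pos hl hp0).ne'
    linarith
  refine ⟨f, ⟨h.bounded_of_flux hf hsecond, fun k => ?_, hf0⟩, h.abs_diff_le hf hsecond⟩
  apply mul_left_cancel₀ (h.pos k).ne'
  have h1 := hf (k - 1)
  rw [sub_add_cancel] at h1
  rw [h.steinOp_mul, hf k, h1, h.steinFlux_sub, steinTest_eq hl]

theorem IsSteinSolution.eq {l x : ℝ} (hl : 0 < l) {f g : ℤ → ℝ}
    (hf : IsSteinSolution l x f) (hg : IsSteinSolution l x g) : f = g :=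
  (isSteinWeight_skellam hl).solution_unique hf.bounded hg.bounded
    (fun k => (hf.equation k).trans (hg.equation k).symm) (hf.initial.trans hg.initial.symm)

theorem theorem5 (lam : ℝ) (hlam : 0 < lam) :
    (∀ x : ℝ, ∃! f : ℤ → ℝ, IsSteinSolution lam x f) ∧
      ∀ f : ℝ → ℤ → ℝ, (∀ x : ℝ, IsSteinSolution lam x (f x)) →
        deltaNorm f ≤ ENNReal.ofReal (156 / (2 * lam)) := by
  refine ⟨fun x => ?_, fun f hf => iSup_le fun x => iSup_le fun j => ENNReal.ofReal_le_ofReal ?_⟩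
  · obtain ⟨f, hf, -⟩ := exists_steinSolution hlam x
    exact ⟨f, hf, fun g hg => hg.eq hlam hf⟩
  · obtain ⟨g, hg, hbound⟩ := exists_steinSolution hlam x
    rw [(hf x).eq hlam hg]
    refine (hbound j).trans ?_
    -- Here `156 / (2 * lam)` is `78 / lam`, well above the `4 / lam` obtained.
    rw [div_le_div_iff₀ hlam (by positivity)]
    linarith
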